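/- Let $\varepsilon>0$ and let $(r_n)_{n\ge1}$ be real numbers with $0\le r_n\le \tfrac12-\varepsilon$. Put $p_n=\tfrac12-r_n$, $q_n=1-p_n$, $f_n(s)=\frac{p_n}{1-q_ns}$ for $s\in[0,1]$, $m_n=f_n'(1)=q_n/p_n$ and $$D(n)=1+\sum_{j=1}^n m_jm_{j+1}\cdots m_n,\qquad n\ge1.$$ Let $(Z_n)_{n\ge0}$ be the branching process in varying environment with geometric offspring distributions and exactly one immigrant per generation, that is, the $\{0,1,2,\dots\}$-valued Markov chain with $Z_0=0$ almost surely and, for all $n\ge1$ and $s\in[0,1]$, $$E\big(s^{Z_n}\mid Z_0,\dots,Z_{n-1}\big)=f_n(s)^{1+Z_{n-1}}\quad\text{almost surely}.$$ Call $n\ge0$ a regeneration time if $Z_n=0$, and, for $k\ge1$, a $k$-strong regeneration time if $Z_n=Z_{n+1}=\dots=Z_{n+k-1}=0$. (1) If $\sum_{n=2}^\infty\frac{1}{D(n)\log n}<\infty$, then almost surely $(Z_n)$ has at most finitely many regeneration times. (2) If there is $\delta>0$ such that $D(n)\le\delta n\log n$ for all sufficiently large $n$, and $\sum_{n=2}^\infty\frac{1}{D(n)\log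 n}=\infty$, then for every $k\ge1$, almost surely $(Z_n)$ has infinitely many $k$-strong regeneration times. -/

import Mathlib

open MeasureTheory Filter

noncomputable section

namespace BPVE

/-- The probability generating function `f_k(s) = p_k / (1 - q_k s)`, `q_k = 1 - p_k`, of the
geometric offspring distribution of generation `k`. -/
def offspringPGF (p : ℕ → ℝ) (k : ℕ) (s : ℝ) : ℝ :=
  p k / (1 - (1 - p k) * s)

/-- The mean offspring number `m_k = f_k'(1) = q_k / p_k`. -/
def offspringMean (p : ℕ → ℝ) (k : ℕ) : ℝ :=
  (1 - p k) / p k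

/-- `q_k / p_k` is the derivative of `f_k` at `1`. -/
theorem hasDerivAt_offspringPGF_one (p : ℕ → ℝ) (k : ℕ) (hp : p k ≠ 0) :
    HasDerivAt (offspringPGF p k) (offspringMean p k) 1 := by
  have h1 : HasDerivAt (fun s : ℝ => 1 - (1 - p k) * s) (-((1 - p k) * 1)) 1 :=
    ((hasDerivAt_id (1 : ℝ)).const_mul (1 - p k)).const_sub 1
  have h2 : (1 - (1 - p k) * 1 : ℝ) ≠ 0 := by simpa using hp
  have h3 := (hasDerivAt_const (1 : ℝ) (p k)).div h1 h2
  refine h3.congr_deriv ?_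
  have h4 : (1 - (1 - p k) * 1 : ℝ) = p k := by ring
  rw [h4]
  unfold offspringMean
  field_simp
  ring

/-- `D(k, n) = 1 + ∑_{j=k}^n m_j ⋯ m_n`. -/
def DD (p : ℕ → ℝ) (k n : ℕ) : ℝ :=
  1 + ∑ j ∈ Finset.Icc k n, ∏ i ∈ Finset.Icc j n, offspringMean p i

/-- `D(n) = D(1, n)`. -/
def D (p : ℕ → ℝ) (n : ℕ) : ℝ :=
  DD p 1 n

/-- The `σ`-algebra generated by `Z_0, …, Z_n`. -/
abbrev history {Ω : Type*} (Z : ℕ → Ω → ℕ) (n : ℕ) : MeasurableSpace Ω :=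
  ⨆ j ∈ Set.Iic n, MeasurableSpace.comap (Z j) ⊤

/-- `Z` is a branching process in varying environment with geometric offspring distributions
(parameters `p_1, p_2, …`) and exactly one immigrant in each generation: `Z_0 = 0` and
`E(s^{Z_{n+1}} | Z_0, …, Z_n) = f_{n+1}(s)^{1 + Z_n}` almost surely, for `n ≥ 0`, `s ∈ [0, 1]`. -/
structure IsBPVEWithImmigration {Ω : Type*} [MeasurableSpace Ω] (μ : Measure Ω)
    (p : ℕ → ℝ) (Z : ℕ → Ω → ℕ) : Prop where
  measurable : ∀ n, Measurable (Z n)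
  zero : ∀ᵐ ω ∂μ, Z 0 ω = 0
  condExp_pgf : ∀ n : ℕ, ∀ s ∈ Set.Icc (0 : ℝ) 1,
    μ[fun ω => s ^ Z (n + 1) ω | history Z n]
      =ᵐ[μ] fun ω => offspringPGF p (n + 1) s ^ (1 + Z n ω)

/-- The set `C` of regeneration times of the path `ω`. -/
def regenerationTimes {Ω : Type*} (Z : ℕ → Ω → ℕ) (ω : Ω) : Set ℕ :=
  {n | Z n ω = 0}

/-- The set `C_k` of `k`-strong regeneration times of the path `ω`:
`n, n + 1, …, n + k - 1` are all regeneration times. -/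
def strongRegenerationTimes {Ω : Type*} (Z : ℕ → Ω → ℕ) (k : ℕ) (ω : Ω) : Set ℕ :=
  {n | ∀ i < k, n + i ∈ regenerationTimes Z ω}

end BPVE

end

/-!
Write `ρ_n = m_1 ⋯ m_n` (`cumMean`) and `S(n) = ∑_{l < n} 1 / ρ_l` (`scale`), so that
`D(i + 1, j) = ρ_j (S(j + 1) - S(i))`.

The maps `f_n` are linear fractional, and `1 - s ↦ 1 - f_n(s)` composes explicitly: started from
`Z_i = 0`, the variable `Z_j` is geometric with mean `D(i + 1, j) - 1`, whatever happened before
time `i` (`setIntegral_pow`). In particular `P(Z_n = 0) = 1 / D(n)` and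
`P(Z_i = Z_j = 0) = 1 / (D(i) D(i + 1, j))`. Everything rests on these probabilities and on
`m_n ≥ 1`, i.e. `ρ` is nondecreasing.

*Finiteness.* If the last zero in `[2a, N]` is at `k`, then, given this, time `n ≤ k` is a zero with
probability at least `1 / (k - n + 1)` (`measureReal_lastZero_le`); this needs only the past of `k`,
since the future of a zero is independent of its past. Hence the conditional expectation of
`∑_{a < n ≤ k} 1_{Z_n = 0} / log n` is at least `log(k - a + 1) / log k ≥ 1 / 2`, and
`P(some zero in [2a, N]) ≤ 2 ∑_{a < n ≤ N} 1 / (D(n) log n)`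
(`measureReal_exists_zero_le`), the tail of a convergent series.

*Infinitude.* Let `X_N = ∑_{n < N} 1_{Z_n = 0} / log n`, whose mean diverges. The ratio
`P(Z_i = Z_j = 0) / (P(Z_i = 0) P(Z_j = 0))` equals `S(j + 1) / (S(j + 1) - S(i))`. The bound
`D(n) ≤ δ n log n` forces `S(j) - S(i) ≥ (S(i) / δ) (log log j - log log i)`, so this ratio is at
most `1 + η` once `j` exceeds a fixed power of `i` (`exists_scale_le`). For the remaining `j` the
bound `P(Z_j = 0 | Z_i = 0) ≤ 1 / (j - i + 1)` contributes a harmonic sum of order `log i`, which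
the weight `1 / log i` turns into a constant. Thus `E X_N² ≤ (1 + η) (E X_N)² + C E X_N` for every
`η > 0`, and Chebyshev's inequality gives `X_N → ∞` almost surely.

*Strong regeneration times.* From any zero, the next time is again a zero with probability
`p_{n+1} ≥ ε`, so Lévy's conditional Borel–Cantelli lemma turns infinitely many runs of `k` zeros
into infinitely many runs of `k + 1` zeros.
-/

open MeasureTheory Filter

noncomputable section

namespace BPVE

/-! ### Algebra of `D` -/

section

variable {p : ℕ → ℝ}

/-- `m_1 ⋯ m_n`, the mean size at time `n` of the progeny of one individual of generation `0`. -/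
def cumMean (p : ℕ → ℝ) (n : ℕ) : ℝ :=
  ∏ i ∈ Finset.Icc 1 n, offspringMean p i

/-- `S(n) = ∑_{l < n} 1 / (m_1 ⋯ m_l)`; the sum excludes `l = n`, so `D(n)` involves `S(n + 1)`. -/
def scale (p : ℕ → ℝ) (n : ℕ) : ℝ :=
  ∑ l ∈ Finset.range n, (cumMean p l)⁻¹

theorem one_le_offspringMean (hp : ∀ n, 1 ≤ n → 0 < p n ∧ p n ≤ 1 / 2) {n : ℕ} (hn : 1 ≤ n) :
    1 ≤ offspringMean p n := by
  obtain ⟨h0, h1⟩ := hp n hn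
  rw [offspringMean, le_div_iff₀ h0]
  linarith

/-- In the form `1 / (1 + m (1 - s))` the pgf of generation `n` is seen to be that of the geometric
distribution on `{0, 1, …}` with mean `m`. -/
theorem offspringPGF_eq (hp : ∀ n, 1 ≤ n → 0 < p n ∧ p n ≤ 1 / 2) {n : ℕ} (hn : 1 ≤ n)
    {s : ℝ} (hs : s ∈ Set.Icc (0 : ℝ) 1) :
    offspringPGF p n s = 1 / (1 + offspringMean p n * (1 - s)) := by
  obtain ⟨h0, h1⟩ := hp n hn
  have h2 : 1 - (1 - p n) * s ≠ 0 := by nlinarith [hs.1, hs.2]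
  have h3 : 1 + offspringMean p n * (1 - s) = (1 - (1 - p n) * s) / p n := by
    rw [offspringMean]
    field_simp
    ring
  rw [h3, offspringPGF, one_div_div]

theorem cumMean_succ (p : ℕ → ℝ) (n : ℕ) :
    cumMean p (n + 1) = cumMean p n * offspringMean p (n + 1) :=
  Finset.prod_Icc_succ_top (by omega) _

theorem cumMean_mono (hp : ∀ n, 1 ≤ n → 0 < p n ∧ p n ≤ 1 / 2) {i j : ℕ} (hij : i ≤ j) :
    cumMean p i ≤ cumMean p j := by
  have hpos : ∀ n, 1 ≤ cumMean p n := fun n =>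
    Finset.prod_induction _ (1 ≤ ·) (fun _ _ => one_le_mul_of_one_le_of_one_le) le_rfl
      fun i hi => one_le_offspringMean hp (Finset.mem_Icc.1 hi).1
  refine monotone_nat_of_le_succ (fun n => ?_) hij
  rw [cumMean_succ]
  exact le_mul_of_one_le_right (by linarith [hpos n]) (one_le_offspringMean hp (by omega))

theorem cumMean_pos (hp : ∀ n, 1 ≤ n → 0 < p n ∧ p n ≤ 1 / 2) (n : ℕ) : 0 < cumMean p n :=
  lt_of_lt_of_le (by simp [cumMean]) (cumMean_mono hp (Nat.zero_le n))

/-- The recursion for `1 +` the mean of a process with one immigrant per generation, started from `0`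
at time `i`. -/
theorem DD_succ (p : ℕ → ℝ) {i j : ℕ} (hij : i ≤ j) :
    DD p (i + 1) (j + 1) = 1 + offspringMean p (j + 1) * DD p (i + 1) j := by
  unfold DD
  rw [Finset.sum_Icc_succ_top (by omega), mul_add, mul_one, Finset.mul_sum, Finset.Icc_self,
    Finset.prod_singleton, add_comm (offspringMean p (j + 1))]
  congr 2
  refine Finset.sum_congr rfl fun l hl => ?_
  rw [Finset.prod_Icc_succ_top (by have := (Finset.mem_Icc.1 hl).2; omega), mul_comm]

theorem DD_self (p : ℕ → ℝ) (i : ℕ) : DD p (i + 1) i = 1 := by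
  simp [DD]

theorem scale_succ (p : ℕ → ℝ) (n : ℕ) : scale p (n + 1) = scale p n + (cumMean p n)⁻¹ :=
  Finset.sum_range_succ _ _

theorem scale_mono (hp : ∀ n, 1 ≤ n → 0 < p n ∧ p n ≤ 1 / 2) : Monotone (scale p) := by
  refine monotone_nat_of_le_succ fun n => ?_
  rw [scale_succ]
  linarith [inv_pos.2 (cumMean_pos hp n)]

theorem scale_nonneg (hp : ∀ n, 1 ≤ n → 0 < p n ∧ p n ≤ 1 / 2) (n : ℕ) : 0 ≤ scale p n := by
  simpa [scale] using scale_mono hp (Nat.zero_le n)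

theorem DD_eq (hp : ∀ n, 1 ≤ n → 0 < p n ∧ p n ≤ 1 / 2) {i j : ℕ} (hij : i ≤ j) :
    DD p (i + 1) j = cumMean p j * (scale p (j + 1) - scale p i) := by
  induction j, hij using Nat.le_induction with
  | base =>
    rw [DD_self, scale_succ, add_sub_cancel_left, mul_inv_cancel₀ (cumMean_pos hp i).ne']
  | succ j hij ih =>
    have h1 := mul_inv_cancel₀ (cumMean_pos hp (j + 1)).ne'
    rw [DD_succ p hij, ih, scale_succ p (j + 1), add_sub_right_comm, mul_add, h1, cumMean_succ]
    ring

theorem D_eq (hp : ∀ n, 1 ≤ n → 0 < p n ∧ p n ≤ 1 / 2) (n : ℕ) :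
    D p n = cumMean p n * scale p (n + 1) := by
  have h := DD_eq hp (Nat.zero_le n)
  simpa [D, scale] using h

theorem le_DD (hp : ∀ n, 1 ≤ n → 0 < p n ∧ p n ≤ 1 / 2) {i j : ℕ} (hij : i ≤ j) :
    (j - i + 1 : ℝ) ≤ DD p (i + 1) j := by
  induction j, hij using Nat.le_induction with
  | base => simp [DD_self]
  | succ j hij ih =>
    rw [DD_succ p hij]
    have h1 := one_le_offspringMean hp (n := j + 1) (by omega)
    have h2 : (i : ℝ) ≤ j := by exact_mod_cast hij
    push_cast
    nlinarith

theorem one_le_DD (hp : ∀ n, 1 ≤ n → 0 < p n ∧ p n ≤ 1 / 2) {i j : ℕ} (hij : i ≤ j) :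
    1 ≤ DD p (i + 1) j := by
  have h2 : (i : ℝ) ≤ j := by exact_mod_cast hij
  linarith [le_DD hp hij]

theorem D_pos (hp : ∀ n, 1 ≤ n → 0 < p n ∧ p n ≤ 1 / 2) (n : ℕ) : 0 < D p n :=
  lt_of_lt_of_le one_pos (one_le_DD hp (Nat.zero_le n))

/-- Since `P(Z_n = Z_k = 0) = 1 / (D(n) D(n + 1, k))` and `P(Z_k = 0) = 1 / D(k)`, this says that
`P(Z_n = 0 | Z_k = 0) ≥ 1 / (k - n + 1)`, a bound backwards in time. -/
theorem D_mul_DD_le (hp : ∀ n, 1 ≤ n → 0 < p n ∧ p n ≤ 1 / 2) {n k : ℕ} (hnk : n ≤ k) :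
    D p n * DD p (n + 1) k ≤ D p k * (k - n + 1) := by
  have key : cumMean p n * (scale p (k + 1) - scale p n) ≤ k - n + 1 := by
    induction k, hnk using Nat.le_induction with
    | base => simp [scale_succ, mul_inv_cancel₀ (cumMean_pos hp n).ne']
    | succ k hnk ih =>
      have h1 : cumMean p n * (cumMean p (k + 1))⁻¹ ≤ 1 := by
        rw [← div_eq_mul_inv, div_le_one (cumMean_pos hp _)]
        exact cumMean_mono hp (by omega)
      rw [scale_succ]
      push_cast
      linarith
  rw [D_eq hp n, D_eq hp k, DD_eq hp hnk]
  have h1 := scale_mono hp (show n + 1 ≤ k + 1 by omega)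
  have h2 := scale_nonneg hp (k + 1)
  have h3 := cumMean_pos hp k
  have h5 : 0 ≤ cumMean p n * (scale p (k + 1) - scale p n) :=
    mul_nonneg (cumMean_pos hp n).le (sub_nonneg.2 (scale_mono hp (by omega)))
  have h4 : (n : ℝ) ≤ k := by exact_mod_cast hnk
  calc cumMean p n * scale p (n + 1) * (cumMean p k * (scale p (k + 1) - scale p n))
      = cumMean p k * scale p (n + 1) *
        (cumMean p n * (scale p (k + 1) - scale p n)) := by ring
    _ ≤ cumMean p k * scale p (k + 1) * (k - n + 1) := by gcongr

end

/-! ### Zeros of the process -/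

section

variable {p : ℕ → ℝ} {Ω : Type*} {Z : ℕ → Ω → ℕ}

theorem history_mono (Z : ℕ → Ω → ℕ) : Monotone (history Z) := fun _ _ hij =>
  biSup_mono fun _ hl => le_trans (Set.mem_Iic.1 hl) hij

theorem measurableSet_history_zero (Z : ℕ → Ω → ℕ) {i n : ℕ} (hin : i ≤ n) :
    MeasurableSet[history Z n] {ω | Z i ω = 0} :=
  (le_biSup (fun j => MeasurableSpace.comap (Z j) ⊤) (Set.mem_Iic.2 hin)) _
    ⟨{0}, MeasurableSpace.measurableSet_top, rfl⟩

/-- The event that `k` is the last zero of the path up to time `N`. -/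
def lastZero (Z : ℕ → Ω → ℕ) (N k : ℕ) : Set Ω :=
  {ω | Z k ω = 0 ∧ ∀ l, k < l → l ≤ N → Z l ω ≠ 0}

theorem pairwise_disjoint_lastZero (Z : ℕ → Ω → ℕ) (N : ℕ) :
    (Set.Iic N).PairwiseDisjoint (lastZero Z N) := by
  intro k hk l hl hkl
  refine Set.disjoint_left.2 fun ω h1 h2 => ?_
  rcases lt_or_gt_of_ne hkl with h | h
  · exact h1.2 l h hl h2.1
  · exact h2.2 k h hk h1.1

theorem exists_mem_lastZero {a N k : ℕ} (hk : k ∈ Finset.Icc a N) {ω : Ω} (hω : Z k ω = 0) :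
    ∃ l ∈ Finset.Icc a N, ω ∈ lastZero Z N l := by
  classical
  have hne : ((Finset.Icc a N).filter fun l => Z l ω = 0).Nonempty :=
    ⟨k, Finset.mem_filter.2 ⟨hk, hω⟩⟩
  have hmem := Finset.mem_filter.1 (Finset.max'_mem _ hne)
  refine ⟨_, hmem.1, hmem.2, fun l hl hlN hl0 => ?_⟩
  refine absurd (Finset.le_max' _ l (Finset.mem_filter.2 ⟨?_, hl0⟩)) (not_le.2 hl)
  exact Finset.mem_Icc.2 ⟨(Finset.mem_Icc.1 hmem.1).1.trans hl.le, hlN⟩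

variable [MeasurableSpace Ω] {μ : Measure Ω}

theorem history_le (hZ : ∀ n, Measurable (Z n)) (n : ℕ) : history Z n ≤ ‹MeasurableSpace Ω› :=
  iSup₂_le fun j _ => (hZ j).comap_le

theorem measurableSet_zero (hZ : ∀ n, Measurable (Z n)) (n : ℕ) :
    MeasurableSet {ω | Z n ω = 0} :=
  hZ n (MeasurableSet.singleton 0)

theorem integrable_pow [IsFiniteMeasure μ] (hZ : ∀ n, Measurable (Z n)) (n : ℕ)
    {s : ℝ} (hs : s ∈ Set.Icc (0 : ℝ) 1) : Integrable (fun ω => s ^ Z n ω) μ := by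
  have hmeas : Measurable fun ω => s ^ Z n ω :=
    (measurable_of_countable fun k : ℕ => s ^ k).comp (hZ n)
  refine Integrable.of_bound hmeas.aestronglyMeasurable 1 (Eventually.of_forall fun ω => ?_)
  rw [Real.norm_of_nonneg (pow_nonneg hs.1 _)]
  exact pow_le_one₀ hs.1 hs.2

/-- On an event of the past on which `Z_i = 0`, the variable `Z_j` is geometric with mean
`D(i + 1, j) - 1`, independently of the event. The equality `Z_i = 0` is only required almost surely
on `A`, so that `A` may be the whole space when `i = 0`. -/
theorem setIntegral_pow [IsFiniteMeasure μ] (hp : ∀ n, 1 ≤ n → 0 < p n ∧ p n ≤ 1 / 2)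
    (hZ : IsBPVEWithImmigration μ p Z) {i j : ℕ} (hij : i ≤ j) {A : Set Ω}
    (hA : MeasurableSet[history Z i] A) (hA0 : ∀ᵐ ω ∂μ, ω ∈ A → Z i ω = 0)
    {s : ℝ} (hs : s ∈ Set.Icc (0 : ℝ) 1) :
    ∫ ω in A, s ^ Z j ω ∂μ = μ.real A / (1 + (1 - s) * (DD p (i + 1) j - 1)) := by
  have hAm : MeasurableSet A := history_le hZ.measurable i A hA
  induction j, hij using Nat.le_induction generalizing s with
  | base =>
    rw [DD_self, setIntegral_congr_ae (g := fun _ => (1 : ℝ)) hAm]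
    · simp
    · filter_upwards [hA0] with ω h1 h2
      rw [h1 h2, pow_zero]
  | succ j hij ih =>
    have hf := offspringPGF_eq hp (show 1 ≤ j + 1 by omega) hs
    have hm := one_le_offspringMean hp (show 1 ≤ j + 1 by omega)
    have hD := one_le_DD hp hij
    have hms : 0 ≤ offspringMean p (j + 1) * (1 - s) :=
      mul_nonneg (by linarith) (by linarith [hs.2])
    have hfs : offspringPGF p (j + 1) s ∈ Set.Icc (0 : ℝ) 1 := by
      rw [hf]
      exact ⟨by positivity, by rw [div_le_one (by linarith)]; linarith⟩
    rw [← setIntegral_condExp (history_le hZ.measurable j)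
        (integrable_pow hZ.measurable (j + 1) hs) (history_mono Z hij A hA),
      setIntegral_congr_ae hAm ((hZ.condExp_pgf j s hs).mono fun ω h _ => h)]
    simp_rw [pow_add, pow_one]
    rw [integral_const_mul, ih hfs, DD_succ p hij, hf]
    set m := offspringMean p (j + 1)
    set d := DD p (i + 1) j
    have h1 : 1 + m * (1 - s) ≠ 0 := by linarith
    have h2 : 1 + (1 - s) * (1 + m * d - 1) ≠ 0 := by nlinarith
    have h3 : 1 + (1 - 1 / (1 + m * (1 - s))) * (d - 1)
        = (1 + (1 - s) * (1 + m * d - 1)) / (1 + m * (1 - s)) := by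
      field_simp
      ring
    rw [h3]
    field_simp

theorem measureReal_inter_zero [IsFiniteMeasure μ] (hp : ∀ n, 1 ≤ n → 0 < p n ∧ p n ≤ 1 / 2)
    (hZ : IsBPVEWithImmigration μ p Z) {i j : ℕ} (hij : i ≤ j) {A : Set Ω}
    (hA : MeasurableSet[history Z i] A) (hA0 : ∀ᵐ ω ∂μ, ω ∈ A → Z i ω = 0) :
    μ.real (A ∩ {ω | Z j ω = 0}) = μ.real A / DD p (i + 1) j := by
  have h := setIntegral_pow hp hZ hij hA hA0 (s := 0) (by simp)
  have h2 : (fun ω => (0 : ℝ) ^ Z j ω) = {ω | Z j ω = 0}.indicator 1 := by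
    ext ω
    by_cases hω : Z j ω = 0 <;> simp [hω]
  rw [h2, setIntegral_indicator (measurableSet_zero hZ.measurable j)] at h
  simpa using h

theorem measureReal_zero [IsProbabilityMeasure μ] (hp : ∀ n, 1 ≤ n → 0 < p n ∧ p n ≤ 1 / 2)
    (hZ : IsBPVEWithImmigration μ p Z) (n : ℕ) : μ.real {ω | Z n ω = 0} = 1 / D p n := by
  have h := measureReal_inter_zero hp hZ (Nat.zero_le n) MeasurableSet.univ
    (hZ.zero.mono fun _ h _ => h)
  simpa [D] using h

theorem measureReal_zero_inter_zero [IsProbabilityMeasure μ]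
    (hp : ∀ n, 1 ≤ n → 0 < p n ∧ p n ≤ 1 / 2)
    (hZ : IsBPVEWithImmigration μ p Z) {i j : ℕ} (hij : i ≤ j) :
    μ.real ({ω | Z i ω = 0} ∩ {ω | Z j ω = 0}) = 1 / (D p i * DD p (i + 1) j) := by
  rw [measureReal_inter_zero hp hZ hij (measurableSet_history_zero Z le_rfl)
    (Eventually.of_forall fun _ h => h), measureReal_zero hp hZ, div_div]

theorem measurableSet_lastZero (hZ : ∀ n, Measurable (Z n)) (N k : ℕ) :
    MeasurableSet (lastZero Z N k) := by
  have : lastZero Z N k = {ω | Z k ω = 0} ∩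
      ⋂ l, ⋂ (_ : k < l), ⋂ (_ : l ≤ N), {ω | Z l ω = 0}ᶜ := by
    ext ω
    simp [lastZero]
  rw [this]
  exact (measurableSet_zero hZ k).inter <| MeasurableSet.iInter fun l =>
    MeasurableSet.iInter fun _ => MeasurableSet.iInter fun _ => (measurableSet_zero hZ l).compl

/-- The Markov property at a zero, for the event of no further zero up to time `N`: its conditional
probability `c` does not depend on the past. Decomposing the complementary event according to the
last zero `l` reduces the claim at `k` to the claims at `l > k`. -/
theorem exists_measureReal_inter_lastZero [IsFiniteMeasure μ]
    (hp : ∀ n, 1 ≤ n → 0 < p n ∧ p n ≤ 1 / 2)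
    (hZ : IsBPVEWithImmigration μ p Z) (N k : ℕ) :
    ∃ c : ℝ, ∀ A, MeasurableSet[history Z k] A → A ⊆ {ω | Z k ω = 0} →
      μ.real (A ∩ lastZero Z N k) = μ.real A * c := by
  induction hd : N - k using Nat.strong_induction_on generalizing k with
  | _ d ih =>
  have ih' : ∀ l, ∃ c : ℝ, l ∈ Finset.Ioc k N → ∀ A, MeasurableSet[history Z l] A →
      A ⊆ {ω | Z l ω = 0} → μ.real (A ∩ lastZero Z N l) = μ.real A * c := by
    intro l
    by_cases hl : l ∈ Finset.Ioc k N
    · have := Finset.mem_Ioc.1 hl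
      obtain ⟨c, hc⟩ := ih (N - l) (by omega) l rfl
      exact ⟨c, fun _ => hc⟩
    · exact ⟨0, fun h => absurd h hl⟩
  choose c hc using ih'
  refine ⟨1 - ∑ l ∈ Finset.Ioc k N, 1 / DD p (k + 1) l * c l, fun A hA hA0 => ?_⟩
  have hAm := history_le hZ.measurable k A hA
  have hsplit : A = (A ∩ lastZero Z N k) ∪ ⋃ l ∈ Finset.Ioc k N, A ∩ lastZero Z N l := by
    ext ω
    simp only [Set.mem_union, Set.mem_inter_iff, Set.mem_iUnion, exists_prop]
    refine ⟨fun h => ?_, by rintro (h | ⟨_, _, h⟩) <;> exact h.1⟩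
    by_cases h2 : ∀ l, k < l → l ≤ N → Z l ω ≠ 0
    · exact Or.inl ⟨h, hA0 h, h2⟩
    · push Not at h2
      obtain ⟨l, hkl, hlN, hl0⟩ := h2
      obtain ⟨l', hl', hω⟩ := exists_mem_lastZero
        (Finset.mem_Icc.2 ⟨Nat.succ_le_of_lt hkl, hlN⟩) hl0
      rw [Finset.mem_Icc] at hl'
      exact Or.inr ⟨l', Finset.mem_Ioc.2 ⟨by omega, hl'.2⟩, h, hω⟩
  have hmeasl : ∀ l, MeasurableSet (A ∩ lastZero Z N l) := fun l =>
    hAm.inter (measurableSet_lastZero hZ.measurable N l)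
  have hdisj : Disjoint (A ∩ lastZero Z N k) (⋃ l ∈ Finset.Ioc k N, A ∩ lastZero Z N l) := by
    refine Set.disjoint_left.2 fun ω h1 h2 => ?_
    simp only [Set.mem_iUnion, exists_prop] at h2
    obtain ⟨l, hl, h3⟩ := h2
    rw [Finset.mem_Ioc] at hl
    exact h1.2.2 l hl.1 hl.2 h3.2.1
  have hsum : μ.real A = μ.real (A ∩ lastZero Z N k)
      + ∑ l ∈ Finset.Ioc k N, μ.real (A ∩ lastZero Z N l) := by
    conv_lhs => rw [hsplit]
    rw [measureReal_union hdisj (Finset.measurableSet_biUnion _ fun l _ => hmeasl l)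
        (measure_ne_top _ _) (measure_ne_top _ _),
      measureReal_biUnion_finset (fun l hl l' hl' h => ?_) fun l _ => hmeasl l]
    simp only [Finset.coe_Ioc, Set.mem_Ioc] at hl hl'
    exact (pairwise_disjoint_lastZero Z N hl.2 hl'.2 h).mono Set.inter_subset_right
      Set.inter_subset_right
  have hterm : ∀ l ∈ Finset.Ioc k N,
      μ.real (A ∩ lastZero Z N l) = μ.real A * (1 / DD p (k + 1) l * c l) := by
    intro l hl
    have hkl : k ≤ l := (Finset.mem_Ioc.1 hl).1.le
    -- A zero at `l` is reached from `A` with probability `1 / D(k + 1, l)`; then the claim at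
    -- `l` applies.
    have h1 : A ∩ lastZero Z N l = (A ∩ {ω | Z l ω = 0}) ∩ lastZero Z N l := by
      ext ω
      simp only [lastZero, Set.mem_inter_iff, Set.mem_ofPred_eq]
      tauto
    rw [h1, hc l hl _ (MeasurableSet.inter (history_mono Z hkl A hA)
      (measurableSet_history_zero Z le_rfl)) Set.inter_subset_right,
      measureReal_inter_zero hp hZ hkl hA (Eventually.of_forall fun _ h => hA0 h)]
    ring
  rw [Finset.sum_congr rfl hterm, ← Finset.mul_sum] at hsum
  linarith

/-- Given that `k` is the last zero up to time `N`, time `n ≤ k` is a zero with conditional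
probability at least `1 / (k - n + 1)`. -/
theorem measureReal_lastZero_le [IsProbabilityMeasure μ]
    (hp : ∀ n, 1 ≤ n → 0 < p n ∧ p n ≤ 1 / 2)
    (hZ : IsBPVEWithImmigration μ p Z) (N : ℕ) {n k : ℕ} (hnk : n ≤ k) :
    μ.real (lastZero Z N k) / (k - n + 1) ≤ μ.real ({ω | Z n ω = 0} ∩ lastZero Z N k) := by
  obtain ⟨c, hc⟩ := exists_measureReal_inter_lastZero hp hZ N k
  have h1 := hc _ (measurableSet_history_zero Z le_rfl) subset_rfl
  have h2 := hc ({ω | Z n ω = 0} ∩ {ω | Z k ω = 0}) (MeasurableSet.inter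
    (measurableSet_history_zero Z hnk) (measurableSet_history_zero Z le_rfl))
    Set.inter_subset_right
  have hsub : {ω | Z k ω = 0} ∩ lastZero Z N k = lastZero Z N k :=
    Set.inter_eq_right.2 fun ω h => h.1
  rw [Set.inter_assoc, hsub, measureReal_zero_inter_zero hp hZ hnk] at h2
  rw [hsub, measureReal_zero hp hZ] at h1
  have hDk := D_pos hp k
  have hc0 : 0 ≤ c := by
    have h3 : 0 ≤ 1 / D p k * c := h1 ▸ measureReal_nonneg
    exact (mul_nonneg_iff_of_pos_left (by positivity)).1 h3
  have hnk' : (n : ℝ) ≤ k := by exact_mod_cast hnk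
  have hle := D_mul_DD_le hp hnk
  have h4 : 0 < D p n * DD p (n + 1) k :=
    mul_pos (D_pos hp n) (by linarith [one_le_DD hp hnk])
  rw [h1, h2, mul_div_right_comm, div_div]
  gcongr

end

/-! ### Finitely many regeneration times -/

section

variable {p : ℕ → ℝ} {Ω : Type*} [MeasurableSpace Ω] {μ : Measure Ω} {Z : ℕ → Ω → ℕ}

theorem log_le_sum_one_div (a b : ℕ) (hab : a ≤ b) :
    Real.log (b - a + 1 : ℝ) ≤ ∑ n ∈ Finset.Ioc a b, 1 / ((b : ℝ) - n + 1) := by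
  have h1 := log_add_one_le_harmonic (b - a)
  have h2 : ((harmonic (b - a) : ℚ) : ℝ) = ∑ n ∈ Finset.Ioc a b, 1 / ((b : ℝ) - n + 1) := by
    rw [harmonic]
    push_cast
    refine Finset.sum_bij' (fun i _ => b - i) (fun n _ => b - n) ?_ ?_ ?_ ?_ ?_
    · intro i hi
      simp only [Finset.mem_range, Finset.mem_Ioc] at *
      omega
    · intro i hi
      simp only [Finset.mem_range, Finset.mem_Ioc] at *
      omega
    · intro i hi
      simp only [Finset.mem_range] at *
      omega
    · intro i hi
      simp only [Finset.mem_Ioc] at *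
      omega
    · intro i hi
      simp only [Finset.mem_range] at *
      rw [Nat.cast_sub (by omega)]
      simp
  rw [← h2]
  convert h1 using 2
  push_cast [Nat.cast_sub hab]
  ring

theorem half_le_sum_one_div_log {a k : ℕ} (ha : 2 ≤ a) (hk : 2 * a ≤ k) :
    1 / 2 ≤ ∑ n ∈ Finset.Ioc a k, (Real.log n)⁻¹ * (1 / ((k : ℝ) - n + 1)) := by
  have hk' : (2 * a : ℝ) ≤ k := by exact_mod_cast hk
  have ha' : (2 : ℝ) ≤ a := by exact_mod_cast ha
  have hlog : 0 < Real.log k := Real.log_pos (by linarith)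
  have h1 : Real.log k ≤ 2 * Real.log (k - a + 1 : ℝ) := by
    rw [show (2 : ℝ) * Real.log (k - a + 1 : ℝ) = Real.log ((k - a + 1 : ℝ) ^ 2) by
      rw [Real.log_pow]; norm_num]
    refine Real.log_le_log (by linarith) ?_
    -- `k ≤ (k - a + 1)²` because `k - a ≥ k / 2`.
    nlinarith
  calc (1 / 2 : ℝ) ≤ (Real.log k)⁻¹ * Real.log (k - a + 1 : ℝ) := by
        rw [inv_mul_eq_div, le_div_iff₀ hlog]
        linarith
    _ ≤ (Real.log k)⁻¹ * ∑ n ∈ Finset.Ioc a k, 1 / ((k : ℝ) - n + 1) := by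
        gcongr
        exact log_le_sum_one_div a k (by omega)
    _ ≤ _ := by
        rw [Finset.mul_sum]
        refine Finset.sum_le_sum fun n hn => ?_
        rw [Finset.mem_Ioc] at hn
        have h2 : (n : ℝ) ≤ k := by exact_mod_cast hn.2
        have h3 : (a : ℝ) < n := by exact_mod_cast hn.1
        have h4 : 0 < Real.log n := Real.log_pos (by linarith)
        have h5 : Real.log n ≤ Real.log k := Real.log_le_log (by linarith) h2
        exact mul_le_mul_of_nonneg_right (inv_anti₀ h4 h5) (one_div_nonneg.2 (by linarith))

theorem measureReal_exists_zero_le [IsProbabilityMeasure μ]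
    (hp : ∀ n, 1 ≤ n → 0 < p n ∧ p n ≤ 1 / 2)
    (hZ : IsBPVEWithImmigration μ p Z) {a : ℕ} (ha : 2 ≤ a) (N : ℕ) :
    μ.real (⋃ k ∈ Finset.Icc (2 * a) N, {ω | Z k ω = 0})
      ≤ 2 * ∑ n ∈ Finset.Ioc a N, 1 / (D p n * Real.log n) := by
  set K := Finset.Icc (2 * a) N
  have hunion : (⋃ k ∈ K, {ω | Z k ω = 0}) ⊆ ⋃ k ∈ K, lastZero Z N k := by
    intro ω hω
    simp only [Set.mem_iUnion, exists_prop] at *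
    obtain ⟨k, hk, hk0⟩ := hω
    exact exists_mem_lastZero hk hk0
  have hdisj : (↑K : Set ℕ).PairwiseDisjoint (lastZero Z N) :=
    (pairwise_disjoint_lastZero Z N).subset fun k hk => (Finset.mem_Icc.1 hk).2
  have hlog : ∀ n ∈ Finset.Ioc a N, 0 ≤ (Real.log n)⁻¹ := fun n _ =>
    inv_nonneg.2 (Real.log_natCast_nonneg n)
  calc μ.real (⋃ k ∈ K, {ω | Z k ω = 0}) ≤ μ.real (⋃ k ∈ K, lastZero Z N k) :=
        measureReal_mono hunion (measure_ne_top _ _)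
    _ ≤ ∑ k ∈ K, μ.real (lastZero Z N k) := measureReal_biUnion_finset_le _ _
    _ ≤ ∑ k ∈ K, 2 * ∑ n ∈ Finset.Ioc a k,
          (Real.log n)⁻¹ * μ.real ({ω | Z n ω = 0} ∩ lastZero Z N k) := by
        refine Finset.sum_le_sum fun k hk => ?_
        have h1 := half_le_sum_one_div_log ha (Finset.mem_Icc.1 hk).1
        have h2 : (∑ n ∈ Finset.Ioc a k, (Real.log n)⁻¹ * (1 / ((k : ℝ) - n + 1)))
            * μ.real (lastZero Z N k) ≤ ∑ n ∈ Finset.Ioc a k,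
              (Real.log n)⁻¹ * μ.real ({ω | Z n ω = 0} ∩ lastZero Z N k) := by
          rw [Finset.sum_mul]
          refine Finset.sum_le_sum fun n hn => ?_
          rw [mul_assoc, one_div_mul_eq_div]
          exact mul_le_mul_of_nonneg_left
            (measureReal_lastZero_le hp hZ N (Finset.mem_Ioc.1 hn).2)
            (inv_nonneg.2 (Real.log_natCast_nonneg n))
        nlinarith [measureReal_nonneg (μ := μ) (s := lastZero Z N k)]
    _ ≤ ∑ k ∈ K, 2 * ∑ n ∈ Finset.Ioc a N,
          (Real.log n)⁻¹ * μ.real ({ω | Z n ω = 0} ∩ lastZero Z N k) := by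
        refine Finset.sum_le_sum fun k hk => mul_le_mul_of_nonneg_left ?_ (by norm_num)
        exact Finset.sum_le_sum_of_subset_of_nonneg
          (Finset.Ioc_subset_Ioc_right (Finset.mem_Icc.1 hk).2)
          fun n hn _ => mul_nonneg (hlog n hn) measureReal_nonneg
    _ = 2 * ∑ n ∈ Finset.Ioc a N,
          (Real.log n)⁻¹ * ∑ k ∈ K, μ.real ({ω | Z n ω = 0} ∩ lastZero Z N k) := by
        rw [← Finset.mul_sum, Finset.sum_comm]
        simp_rw [Finset.mul_sum]
    _ ≤ _ := by
        refine mul_le_mul_of_nonneg_left (Finset.sum_le_sum fun n hn => ?_) (by norm_num)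
        have h3 : ∑ k ∈ K, μ.real ({ω | Z n ω = 0} ∩ lastZero Z N k) ≤ 1 / D p n := by
          rw [← measureReal_zero hp hZ n, ← measureReal_biUnion_finset
            (hdisj.mono fun _ => Set.inter_subset_right)
            fun k _ => (measurableSet_zero hZ.measurable n).inter
              (measurableSet_lastZero hZ.measurable N k)]
          exact measureReal_mono (Set.iUnion₂_subset fun _ _ => Set.inter_subset_left)
        calc _ ≤ (Real.log n)⁻¹ * (1 / D p n) := mul_le_mul_of_nonneg_left h3 (hlog n hn)
          _ = _ := by rw [← one_div, one_div_mul_one_div, mul_comm]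

theorem ae_finite_zeros [IsProbabilityMeasure μ]
    (hp : ∀ n, 1 ≤ n → 0 < p n ∧ p n ≤ 1 / 2)
    (hZ : IsBPVEWithImmigration μ p Z)
    (hsum : Summable fun n : ℕ => 1 / (D p n * Real.log n)) :
    ∀ᵐ ω ∂μ, (regenerationTimes Z ω).Finite := by
  rw [ae_iff]
  refine le_antisymm (ENNReal.le_of_forall_pos_le_add fun η hη _ => ?_) zero_le
  rw [zero_add]
  have hη2 : (0 : ℝ) < η / 2 := by positivity
  obtain ⟨s, hs⟩ := summable_iff_vanishing_norm.1 hsum (η / 2) hη2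
  set a := s.sup id + 2
  have hsub : {ω | ¬ (regenerationTimes Z ω).Finite}
      ⊆ ⋃ N, ⋃ k ∈ Finset.Icc (2 * a) N, {ω | Z k ω = 0} := by
    intro ω hω
    obtain ⟨k, hk, hak⟩ := Set.Infinite.exists_gt hω (2 * a)
    simp only [Set.mem_iUnion, exists_prop]
    exact ⟨k, k, Finset.mem_Icc.2 ⟨hak.le, le_rfl⟩, hk⟩
  have hmono : Monotone fun N => ⋃ k ∈ Finset.Icc (2 * a) N, {ω | Z k ω = 0} := fun N M hNM =>
    Set.biUnion_subset_biUnion_left (Finset.Icc_subset_Icc_right hNM)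
  refine (measure_mono hsub).trans ?_
  rw [hmono.measure_iUnion]
  refine iSup_le fun N => ?_
  rw [← ENNReal.ofReal_coe_nnreal, ← ofReal_measureReal (h := measure_ne_top _ _)]
  refine ENNReal.ofReal_le_ofReal ((measureReal_exists_zero_le hp hZ (by omega) N).trans ?_)
  have h1 := hs (Finset.Ioc a N) (Finset.disjoint_left.2 fun n hn hns => by
    have h2 : n ≤ s.sup id := Finset.le_sup (f := id) hns
    have := (Finset.mem_Ioc.1 hn).1
    omega)
  linarith [(le_abs_self _).trans_lt h1]

end

/-! ### Infinitely many regeneration times -/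

section

variable {p : ℕ → ℝ} {Ω : Type*} [MeasurableSpace Ω] {μ : Measure Ω} {Z : ℕ → Ω → ℕ}

/-- Weighted second moment Borel–Cantelli lemma: if the weighted expected number `E` of occurrences
diverges and its second moment is at most `(1 + o(1)) E²`, then almost surely infinitely many of the
events occur. -/
theorem ae_infinite_of_second_moment [IsProbabilityMeasure μ] {A : ℕ → Set Ω}
    (hA : ∀ n, MeasurableSet (A n)) {w : ℕ → ℝ} (hw : ∀ n, 0 ≤ w n)
    (hdiv : Tendsto (fun N => ∑ n ∈ Finset.range N, w n * μ.real (A n)) atTop atTop)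
    (hcorr : ∀ η : ℝ, 0 < η → ∃ C : ℝ, ∀ N,
      ∑ i ∈ Finset.range N, ∑ j ∈ Finset.range N, w i * w j * μ.real (A i ∩ A j) ≤
        (1 + η) * (∑ n ∈ Finset.range N, w n * μ.real (A n)) ^ 2
          + C * ∑ n ∈ Finset.range N, w n * μ.real (A n)) :
    ∀ᵐ ω ∂μ, {n | ω ∈ A n}.Infinite := by
  set X : ℕ → Ω → ℝ := fun N ω => ∑ n ∈ Finset.range N, w n * (A n).indicator 1 ω with hX
  set e : ℕ → ℝ := fun N => ∑ n ∈ Finset.range N, w n * μ.real (A n) with he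
  have hind : ∀ s : Set Ω, MeasurableSet s → Integrable (s.indicator (1 : Ω → ℝ)) μ := fun s hs =>
    (integrable_const (1 : ℝ)).indicator hs
  have hLp : ∀ N, MemLp (X N) 2 μ := fun N =>
    memLp_finsetSum _ fun n _ => ((memLp_const (1 : ℝ)).indicator (hA n)).const_mul (w n)
  have hmean : ∀ N, ∫ ω, X N ω ∂μ = e N := by
    intro N
    rw [hX, he]
    simp only
    rw [integral_finsetSum _ fun n _ => (hind _ (hA n)).const_mul (w n)]
    refine Finset.sum_congr rfl fun n _ => ?_
    rw [integral_const_mul, integral_indicator_one (hA n)]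
  have hsq : ∀ N, ∫ ω, (X N ^ 2) ω ∂μ
      = ∑ i ∈ Finset.range N, ∑ j ∈ Finset.range N, w i * w j * μ.real (A i ∩ A j) := by
    intro N
    have h1 : X N ^ 2 = fun ω => ∑ i ∈ Finset.range N, ∑ j ∈ Finset.range N,
        w i * w j * (A i ∩ A j).indicator 1 ω := by
      ext ω
      rw [Pi.pow_apply, hX, pow_two, Finset.sum_mul_sum]
      refine Finset.sum_congr rfl fun i _ => Finset.sum_congr rfl fun j _ => ?_
      rw [Set.inter_indicator_one, Pi.mul_apply]
      ring
    rw [h1, integral_finsetSum _ fun i _ => integrable_finsetSum _ fun j _ =>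
      (hind _ ((hA i).inter (hA j))).const_mul _]
    refine Finset.sum_congr rfl fun i _ => ?_
    rw [integral_finsetSum _ fun j _ => (hind _ ((hA i).inter (hA j))).const_mul _]
    refine Finset.sum_congr rfl fun j _ => ?_
    rw [integral_const_mul, integral_indicator_one ((hA i).inter (hA j))]
  -- Chebyshev: `X N ≤ M ≤ e N / 2` has probability at most `4 Var (X N) / (e N)²`.
  have hnull : ∀ M : ℕ, μ {ω | ∀ N, X N ω ≤ M} = 0 := by
    intro M
    refine le_antisymm (ENNReal.le_of_forall_pos_le_add fun η hη _ => ?_) zero_le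
    rw [zero_add]
    have hη' : (0 : ℝ) < η := hη
    obtain ⟨C, hC⟩ := hcorr (η / 8) (by positivity)
    obtain ⟨N, hN⟩ := (hdiv.eventually_ge_atTop (max (2 * M + 1) (C / (η / 8)))).exists
    have hN1 : (2 * M + 1 : ℝ) ≤ e N := (le_max_left _ _).trans hN
    have hN2 : C ≤ e N * (η / 8) := by
      rw [← div_le_iff₀ (by positivity)]
      exact (le_max_right _ _).trans hN
    have hM0 : (0 : ℝ) ≤ M := M.cast_nonneg
    have he0 : 0 < e N := by linarith
    have hsub : {ω | ∀ N, X N ω ≤ M} ⊆ {ω | e N / 2 ≤ |X N ω - ∫ ω, X N ω ∂μ|} := by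
      intro ω hω
      have h2 : X N ω ≤ M := hω N
      simp only [Set.mem_ofPred_eq]
      rw [hmean, abs_sub_comm]
      exact le_trans (by linarith) (le_abs_self _)
    refine (measure_mono hsub).trans
      ((ProbabilityTheory.meas_ge_le_variance_div_sq (hLp N) (half_pos he0)).trans ?_)
    rw [← ENNReal.ofReal_coe_nnreal]
    refine ENNReal.ofReal_le_ofReal ?_
    rw [ProbabilityTheory.variance_eq_sub (hLp N), hmean, hsq, div_le_iff₀ (by positivity)]
    have h3 := hC N
    have h4 : C * e N ≤ e N * (η / 8) * e N := mul_le_mul_of_nonneg_right hN2 he0.le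
    nlinarith
  rw [ae_iff]
  refine measure_mono_null (t := ⋃ M : ℕ, {ω | ∀ N, X N ω ≤ M}) ?_ (measure_iUnion_null hnull)
  intro ω hω
  have hfin : {n | ω ∈ A n}.Finite := Set.not_infinite.1 hω
  obtain ⟨M, hM⟩ := exists_nat_ge (∑ n ∈ hfin.toFinset, w n)
  refine Set.mem_iUnion.2 ⟨M, fun N => le_trans ?_ hM⟩
  have h1 : ∀ n, w n * (A n).indicator 1 ω = if n ∈ hfin.toFinset then w n else 0 := by
    intro n
    by_cases h : ω ∈ A n <;> simp [h]
  rw [hX]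
  simp only [h1]
  rw [← Finset.sum_filter, Finset.filter_mem_eq_inter]
  exact Finset.sum_le_sum_of_subset_of_nonneg Finset.inter_subset_right fun n _ _ => hw n

theorem log_log_succ_sub_le {j : ℕ} (hj : 2 ≤ j) :
    Real.log (Real.log (j + 1 : ℕ)) - Real.log (Real.log j) ≤ 1 / (j * Real.log j) := by
  have hj' : (2 : ℝ) ≤ j := by exact_mod_cast hj
  have h0 : 0 < Real.log j := Real.log_pos (by linarith)
  have h1 : 0 < Real.log (j + 1 : ℕ) := Real.log_pos (by push_cast; linarith)
  have h2 : Real.log (j + 1 : ℕ) - Real.log j ≤ 1 / j := by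
    rw [← Real.log_div (by positivity) (by positivity)]
    refine (Real.log_le_sub_one_of_pos (by positivity)).trans (le_of_eq ?_)
    push_cast
    field_simp
    ring
  rw [← Real.log_div h1.ne' h0.ne']
  refine (Real.log_le_sub_one_of_pos (div_pos h1 h0)).trans ?_
  rw [div_sub_one h0.ne', ← div_div]
  gcongr

/-- If `D(n) ≤ δ n log n`, then the increments of `S` satisfy
`S(n + 1) - S(n) = S(n + 1) / D(n) ≥ S(n) / (δ n log n)`, which sum to a
`log log` lower bound for the relative growth of `S`. -/
theorem le_scale_sub_scale (hp : ∀ n, 1 ≤ n → 0 < p n ∧ p n ≤ 1 / 2) {δ : ℝ} (hδ : 0 < δ)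
    {n₀ : ℕ} (hn₀ : 2 ≤ n₀) (hD : ∀ n, n₀ ≤ n → D p n ≤ δ * n * Real.log n)
    {i j : ℕ} (hi : n₀ ≤ i) (hij : i ≤ j) :
    scale p i / δ * (Real.log (Real.log j) - Real.log (Real.log i)) ≤ scale p j - scale p i := by
  induction j, hij using Nat.le_induction with
  | base => simp
  | succ j hij ih =>
    have hj : (2 : ℝ) ≤ j := by exact_mod_cast hn₀.trans (hi.trans hij)
    have hlog : 0 < Real.log j := Real.log_pos (by linarith)
    have h1 := log_log_succ_sub_le (hn₀.trans (hi.trans hij))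
    have h2 := hD j (hi.trans hij)
    rw [D_eq hp] at h2
    have h3 : scale p i ≤ scale p (j + 1) := scale_mono hp (by omega)
    have h4 : scale p i / δ * (1 / (j * Real.log j)) ≤ (cumMean p j)⁻¹ := by
      rw [div_mul_div_comm, mul_one, div_le_iff₀ (by positivity), inv_mul_eq_div,
        le_div_iff₀ (cumMean_pos hp j)]
      nlinarith [cumMean_pos hp j]
    have h5 : scale p i / δ * (Real.log (Real.log (j + 1 : ℕ)) - Real.log (Real.log j))
        ≤ scale p i / δ * (1 / (j * Real.log j)) :=
      mul_le_mul_of_nonneg_left h1 (div_nonneg (scale_nonneg hp i) hδ.le)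
    have h6 := scale_succ p j
    linarith

/-- Beyond a fixed power of (a multiple of) `i`, the correlation ratio
`S(j + 1) / (S(j + 1) - S(i))` of zeros at `i` and `j` is at most `1 + η`. -/
theorem exists_scale_le (hp : ∀ n, 1 ≤ n → 0 < p n ∧ p n ≤ 1 / 2) {δ : ℝ} (hδ : 0 < δ)
    (hD : ∀ᶠ n : ℕ in atTop, D p n ≤ δ * n * Real.log n) {η : ℝ} (hη : 0 < η) :
    ∃ K i₀ : ℕ, 1 ≤ i₀ ∧ ∀ i j : ℕ, 2 ≤ i → (i * i₀) ^ K ≤ j →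
      scale p i ≤ η * (scale p (j + 1) - scale p i) := by
  obtain ⟨n₀, hn₀⟩ := eventually_atTop.1 hD
  obtain ⟨K, hK⟩ := exists_nat_ge (Real.exp (δ / η))
  refine ⟨K, max n₀ 2, by omega, fun i j hi hj => ?_⟩
  set i' := i * max n₀ 2
  have hii' : i ≤ i' := Nat.le_mul_of_pos_right i (by omega)
  have hi' : max n₀ 2 ≤ i' := Nat.le_mul_of_pos_left _ (by omega)
  have hK0 : (0 : ℝ) < K := (Real.exp_pos _).trans_le hK
  have hij' : i' ≤ j := le_trans (Nat.le_self_pow (by rintro rfl; simp at hK0) _) hj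
  have hgrow := le_scale_sub_scale hp hδ (le_max_right n₀ 2)
    (fun n hn => hn₀ n ((le_max_left _ _).trans hn)) hi' hij'
  have hi2 : (2 : ℝ) ≤ i' := by exact_mod_cast (le_max_right _ _).trans hi'
  have hlog : 0 < Real.log i' := Real.log_pos (by linarith)
  have h1 : δ / η ≤ Real.log (Real.log j) - Real.log (Real.log i') := by
    have h2 : K * Real.log i' ≤ Real.log j := by
      rw [← Real.log_pow]
      exact Real.log_le_log (by positivity) (by exact_mod_cast hj)
    have h3 := Real.log_le_log (by positivity) h2
    rw [Real.log_mul hK0.ne' hlog.ne'] at h3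
    have h4 : δ / η ≤ Real.log K := (Real.le_log_iff_exp_le hK0).2 hK
    linarith
  have h5 : scale p i' / η ≤ scale p j - scale p i' := by
    refine le_trans (le_of_eq ?_) ((mul_le_mul_of_nonneg_left h1
      (div_nonneg (scale_nonneg hp i') hδ.le)).trans hgrow)
    field_simp
  rw [div_le_iff₀ hη] at h5
  have h6 := scale_mono hp hii'
  have h7 := scale_mono hp (Nat.le_succ j)
  refine h6.trans (h5.trans ?_)
  rw [mul_comm]
  gcongr

theorem sum_one_div_le (i J N : ℕ) :
    ∑ j ∈ Finset.range N, (if i ≤ j ∧ j < J then 1 / ((j : ℝ) - i + 1) else 0)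
      ≤ 1 + Real.log J := by
  have hpos : ∀ k : ℕ, 0 ≤ ((k : ℝ) + 1)⁻¹ := fun k => by positivity
  rw [← Finset.sum_filter]
  calc _ ≤ ∑ j ∈ Finset.Ico i J, 1 / ((j : ℝ) - i + 1) := by
        refine Finset.sum_le_sum_of_subset_of_nonneg (fun j hj => ?_) fun j hj _ => ?_
        · exact Finset.mem_Ico.2 (Finset.mem_filter.1 hj).2
        · have : (i : ℝ) ≤ j := by exact_mod_cast (Finset.mem_Ico.1 hj).1
          exact one_div_nonneg.2 (by linarith)
    _ = ∑ k ∈ Finset.range (J - i), ((k : ℝ) + 1)⁻¹ := by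
        rw [Finset.sum_Ico_eq_sum_range]
        refine Finset.sum_congr rfl fun k _ => ?_
        push_cast
        rw [add_sub_cancel_left, one_div]
    _ ≤ ∑ k ∈ Finset.range J, ((k : ℝ) + 1)⁻¹ :=
        Finset.sum_le_sum_of_subset_of_nonneg (Finset.range_mono (Nat.sub_le J i))
          fun k _ _ => hpos k
    _ ≤ 1 + Real.log J := by
        have := harmonic_le_one_add_log J
        rw [harmonic] at this
        push_cast at this
        exact this

theorem ae_infinite_zeros [IsProbabilityMeasure μ]
    (hp : ∀ n, 1 ≤ n → 0 < p n ∧ p n ≤ 1 / 2)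
    (hZ : IsBPVEWithImmigration μ p Z) {δ : ℝ} (hδ : 0 < δ)
    (hD : ∀ᶠ n : ℕ in atTop, D p n ≤ δ * n * Real.log n)
    (hsum : ¬ Summable fun n : ℕ => 1 / (D p n * Real.log n)) :
    ∀ᵐ ω ∂μ, (regenerationTimes Z ω).Infinite := by
  have hw : ∀ n : ℕ, 0 ≤ (Real.log n)⁻¹ := fun n => inv_nonneg.2 (Real.log_natCast_nonneg n)
  refine ae_infinite_of_second_moment (A := fun n => {ω | Z n ω = 0})
    (measurableSet_zero hZ.measurable) hw ?_ fun η hη => ?_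
  · refine ((not_summable_iff_tendsto_nat_atTop_of_nonneg fun n => ?_).1 hsum).congr fun N =>
      Finset.sum_congr rfl fun n _ => ?_
    · exact one_div_nonneg.2 (mul_nonneg (D_pos hp n).le (Real.log_natCast_nonneg n))
    · rw [measureReal_zero hp hZ, ← one_div, one_div_mul_one_div, mul_comm]
  obtain ⟨K, i₀, hi₀, hscale⟩ := exists_scale_le hp hδ hD hη
  set w : ℕ → ℝ := fun n => (Real.log n)⁻¹ with hwdef
  set P : ℕ → ℕ → ℝ := fun i j => μ.real ({ω | Z i ω = 0} ∩ {ω | Z j ω = 0}) with hP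
  -- `h i j` dominates `P i j` for the `j` too close to `i` for near-independence.
  set h : ℕ → ℕ → ℝ := fun i j =>
    1 / D p i * (if i ≤ j ∧ j < (i * i₀) ^ K then 1 / ((j : ℝ) - i + 1) else 0) with hh
  have hh0 : ∀ i j, 0 ≤ h i j := by
    intro i j
    refine mul_nonneg (one_div_nonneg.2 (D_pos hp i).le) ?_
    split_ifs with hij
    · have : (i : ℝ) ≤ j := by exact_mod_cast hij.1
      exact one_div_nonneg.2 (by linarith)
    · exact le_rfl
  have hle : ∀ i j, 2 ≤ i → i ≤ j →
      P i j ≤ (1 + η) * (1 / D p i * (1 / D p j)) + h i j := by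
    intro i j hi hij
    have hDi := D_pos hp i
    have hDj := D_pos hp j
    have hDD := one_le_DD hp hij
    have hPij : P i j = 1 / D p i * (1 / DD p (i + 1) j) := by
      rw [one_div_mul_one_div]
      exact measureReal_zero_inter_zero hp hZ hij
    rw [hPij]
    by_cases hj : j < (i * i₀) ^ K
    · have h1 : h i j = 1 / D p i * (1 / ((j : ℝ) - i + 1)) := by
        rw [hh]
        simp only
        rw [if_pos ⟨hij, hj⟩]
      have h2 : (i : ℝ) ≤ j := by exact_mod_cast hij
      have h3 : 1 / D p i * (1 / DD p (i + 1) j) ≤ h i j := by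
        rw [h1]
        exact mul_le_mul_of_nonneg_left (one_div_le_one_div_of_le (by linarith) (le_DD hp hij))
          (by positivity)
      have h4 : 0 ≤ (1 + η) * (1 / D p i * (1 / D p j)) := by positivity
      linarith
    · have h1 := hscale i j hi (not_lt.1 hj)
      have h2 : D p j ≤ (1 + η) * DD p (i + 1) j := by
        rw [D_eq hp, DD_eq hp hij]
        nlinarith [cumMean_pos hp j]
      have h3 : 1 / DD p (i + 1) j ≤ (1 + η) * (1 / D p j) := by
        rw [mul_one_div, div_le_div_iff₀ (by linarith) hDj]
        linarith
      have h4 := mul_le_mul_of_nonneg_left h3 (one_div_nonneg.2 hDi.le)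
      linarith [hh0 i j]
  have hle' : ∀ i j, w i * w j * P i j ≤ (1 + η) * ((w i * (1 / D p i)) * (w j * (1 / D p j)))
      + (w i * w j * h i j + w j * w i * h j i) := by
    intro i j
    -- The weights at `0` and `1` vanish: `log 0 = log 1 = 0` and `0⁻¹ = 0`.
    by_cases hi : i < 2
    · have : w i = 0 := by interval_cases i <;> simp [hwdef]
      simp [this]
    by_cases hj : j < 2
    · have : w j = 0 := by interval_cases j <;> simp [hwdef]
      simp [this]
    have h1 : P i j ≤ (1 + η) * (1 / D p i * (1 / D p j)) + (h i j + h j i) := by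
      rcases le_total i j with hij | hij
      · linarith [hle i j (by omega) hij, hh0 j i]
      · have := hle j i (by omega) hij
        have h2 : P i j = P j i := by rw [hP]; simp only; rw [Set.inter_comm]
        linarith [hh0 i j]
    have h3 := mul_le_mul_of_nonneg_left h1 (mul_nonneg (hw i) (hw j))
    refine h3.trans (le_of_eq ?_)
    ring
  set C : ℝ := (Real.log 2)⁻¹ * (1 + K * Real.log i₀) + K with hC
  have hlogi₀ : 0 ≤ Real.log i₀ := Real.log_natCast_nonneg i₀
  have hrow : ∀ i N, ∑ j ∈ Finset.range N, w i * w j * h i j ≤ C * (w i * (1 / D p i)) := by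
    intro i N
    by_cases hi : i < 2
    · have : w i = 0 := by interval_cases i <;> simp [hwdef]
      simp [this]
    have hi2 : (2 : ℝ) ≤ i := by exact_mod_cast not_lt.1 hi
    have hlog2 : 0 < Real.log 2 := Real.log_pos (by norm_num)
    have hlog : Real.log 2 ≤ Real.log i := Real.log_le_log (by norm_num) hi2
    have hwa : 0 ≤ w i * (1 / D p i) :=
      mul_nonneg (hw i) (one_div_nonneg.2 (D_pos hp i).le)
    have hi0' : (1 : ℝ) ≤ i₀ := by exact_mod_cast hi₀
    calc ∑ j ∈ Finset.range N, w i * w j * h i j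
        ≤ ∑ j ∈ Finset.range N, w i * (1 / D p i) * (w i *
          (if i ≤ j ∧ j < (i * i₀) ^ K then 1 / ((j : ℝ) - i + 1) else 0)) := by
          refine Finset.sum_le_sum fun j _ => ?_
          rw [hh]
          simp only
          split_ifs with hij
          · have h1 : (i : ℝ) ≤ j := by exact_mod_cast hij.1
            have h2 : w j ≤ w i := inv_anti₀ (by linarith) (Real.log_le_log (by linarith) h1)
            have h3 : 0 ≤ w i * (1 / D p i) * (1 / ((j : ℝ) - i + 1)) :=
              mul_nonneg hwa (one_div_nonneg.2 (by linarith))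
            nlinarith
          · simp
      _ = w i * (1 / D p i) * (w i * ∑ j ∈ Finset.range N,
          (if i ≤ j ∧ j < (i * i₀) ^ K then 1 / ((j : ℝ) - i + 1) else 0)) := by
          rw [Finset.mul_sum, Finset.mul_sum]
      _ ≤ w i * (1 / D p i) * (w i * (1 + Real.log ((i * i₀) ^ K : ℕ))) := by
          refine mul_le_mul_of_nonneg_left (mul_le_mul_of_nonneg_left ?_ (hw i)) hwa
          exact sum_one_div_le i _ N
      _ ≤ w i * (1 / D p i) * C := by
          refine mul_le_mul_of_nonneg_left ?_ hwa
          push_cast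
          rw [Real.log_pow, Real.log_mul (by linarith) (by linarith)]
          have h1 : w i * Real.log i = 1 := inv_mul_cancel₀ (by linarith)
          have h2 : w i ≤ (Real.log 2)⁻¹ := inv_anti₀ hlog2 hlog
          have h3 : w i * (1 + K * Real.log i₀) ≤ (Real.log 2)⁻¹ * (1 + K * Real.log i₀) :=
            mul_le_mul_of_nonneg_right h2 (by positivity)
          rw [hC]
          linear_combination h3 + K * h1
      _ = C * (w i * (1 / D p i)) := mul_comm _ _
  refine ⟨2 * C, fun N => ?_⟩
  have ha : ∀ n, μ.real {ω | Z n ω = 0} = 1 / D p n := measureReal_zero hp hZ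
  simp only [ha]
  calc ∑ i ∈ Finset.range N, ∑ j ∈ Finset.range N, w i * w j * P i j
      ≤ ∑ i ∈ Finset.range N, ∑ j ∈ Finset.range N,
        ((1 + η) * ((w i * (1 / D p i)) * (w j * (1 / D p j)))
          + (w i * w j * h i j + w j * w i * h j i)) :=
        Finset.sum_le_sum fun i _ => Finset.sum_le_sum fun j _ => hle' i j
    _ = (1 + η) * (∑ n ∈ Finset.range N, w n * (1 / D p n)) ^ 2
        + 2 * ∑ i ∈ Finset.range N, ∑ j ∈ Finset.range N, w i * w j * h i j := by
        simp only [Finset.sum_add_distrib]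
        rw [Finset.sum_comm (f := fun i j => w j * w i * h j i), pow_two, Finset.sum_mul_sum,
          Finset.mul_sum, two_mul]
        simp only [Finset.mul_sum]
    _ ≤ (1 + η) * (∑ n ∈ Finset.range N, w n * (1 / D p n)) ^ 2
        + 2 * ∑ i ∈ Finset.range N, C * (w i * (1 / D p i)) := by
        have := Finset.sum_le_sum fun i (_ : i ∈ Finset.range N) => hrow i N
        linarith
    _ = _ := by
        rw [← Finset.mul_sum]
        ring

end

/-! ### Strong regeneration times -/

section

variable {p : ℕ → ℝ} {Ω : Type*} {Z : ℕ → Ω → ℕ}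

/-- The event that `k` consecutive zeros end at time `n`. Runs are indexed by their last time, so that
the event belongs to the history up to `n`; it is empty if `n + 1 < k`. -/
def zeroRunEndingAt (Z : ℕ → Ω → ℕ) (k n : ℕ) : Set Ω :=
  {ω | ∃ a, a + k = n + 1 ∧ ∀ i < k, Z (a + i) ω = 0}

theorem zeroRunEndingAt_succ_succ (Z : ℕ → Ω → ℕ) {k : ℕ} (n : ℕ) :
    zeroRunEndingAt Z (k + 1) (n + 1) = zeroRunEndingAt Z k n ∩ {ω | Z (n + 1) ω = 0} := by
  ext ω
  simp only [zeroRunEndingAt, Set.mem_inter_iff, Set.mem_ofPred_eq]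
  constructor
  · rintro ⟨a, ha, h⟩
    have h1 := h k (by omega)
    rw [show a + k = n + 1 by omega] at h1
    exact ⟨⟨a, by omega, fun i hi => h i (by omega)⟩, h1⟩
  · rintro ⟨⟨a, ha, h⟩, h1⟩
    refine ⟨a, by omega, fun i hi => ?_⟩
    rcases Nat.lt_succ_iff_lt_or_eq.1 hi with hi | rfl
    · exact h i hi
    · rwa [ha]

theorem eq_zero_of_mem_zeroRunEndingAt {k n : ℕ} (hk : 1 ≤ k) {ω : Ω}
    (hω : ω ∈ zeroRunEndingAt Z k n) : Z n ω = 0 := by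
  obtain ⟨a, ha, h⟩ := hω
  have := h (k - 1) (by omega)
  rwa [show a + (k - 1) = n by omega] at this

theorem measurableSet_zeroRunEndingAt (Z : ℕ → Ω → ℕ) (k n : ℕ) :
    MeasurableSet[history Z n] (zeroRunEndingAt Z k n) := by
  have : zeroRunEndingAt Z k n =
      ⋃ a, ⋃ (_ : a + k = n + 1), ⋂ i, ⋂ (_ : i < k), {ω | Z (a + i) ω = 0} := by
    ext ω
    simp [zeroRunEndingAt]
  rw [this]
  exact MeasurableSet.iUnion fun a => MeasurableSet.iUnion fun ha => MeasurableSet.iInter fun i =>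
    MeasurableSet.iInter fun hi => measurableSet_history_zero Z (by omega)

theorem mem_limsup_zeroRunEndingAt {k : ℕ} (hk : 1 ≤ k) {ω : Ω} :
    ω ∈ limsup (zeroRunEndingAt Z k) atTop ↔ (strongRegenerationTimes Z k ω).Infinite := by
  rw [mem_limsup_iff_frequently_mem, show (strongRegenerationTimes Z k ω).Infinite ↔
    ∃ᶠ n in atTop, n ∈ strongRegenerationTimes Z k ω from
      Nat.frequently_atTop_iff_infinite.symm, frequently_atTop, frequently_atTop]
  constructor
  · intro h b
    obtain ⟨n, hn, a, ha, h0⟩ := h (b + k)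
    exact ⟨a, by omega, h0⟩
  · intro h b
    obtain ⟨a, ha, h0⟩ := h b
    exact ⟨a + k - 1, by omega, a, by omega, h0⟩

variable [MeasurableSpace Ω] {μ : Measure Ω}

/-- The histories `σ(Z_0, …, Z_n)` as a filtration. -/
def historyFiltration (hZ : ∀ n, Measurable (Z n)) : Filtration ℕ ‹MeasurableSpace Ω› where
  seq := history Z
  mono' := history_mono Z
  le' := history_le hZ

/-- A run of `k ≥ 1` zeros ending at time `n` is prolonged with conditional probability `p_{n+1}`. -/
theorem condExp_zeroRunEndingAt_succ [IsFiniteMeasure μ] (hZ : IsBPVEWithImmigration μ p Z)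
    {k : ℕ} (hk : 1 ≤ k) (n : ℕ) :
    μ[(zeroRunEndingAt Z (k + 1) (n + 1)).indicator (1 : Ω → ℝ) | history Z n]
      =ᵐ[μ] (zeroRunEndingAt Z k n).indicator fun _ => p (n + 1) := by
  have h1 : (zeroRunEndingAt Z (k + 1) (n + 1)).indicator (1 : Ω → ℝ)
      = (zeroRunEndingAt Z k n).indicator fun ω => (0 : ℝ) ^ Z (n + 1) ω := by
    rw [zeroRunEndingAt_succ_succ, ← Set.indicator_indicator]
    congr 1
    ext ω
    by_cases hω : Z (n + 1) ω = 0 <;> simp [hω]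
  rw [h1]
  refine (condExp_indicator (integrable_pow hZ.measurable (n + 1) (by simp))
    (measurableSet_zeroRunEndingAt Z k n)).trans ?_
  filter_upwards [hZ.condExp_pgf n 0 (by simp)] with ω h2
  by_cases hω : ω ∈ zeroRunEndingAt Z k n
  · rw [Set.indicator_of_mem hω, Set.indicator_of_mem hω, h2,
      eq_zero_of_mem_zeroRunEndingAt hk hω]
    simp [offspringPGF]
  · rw [Set.indicator_of_notMem hω, Set.indicator_of_notMem hω]

theorem ae_infinite_strongRegenerationTimes [IsFiniteMeasure μ]
    (hZ : IsBPVEWithImmigration μ p Z) {ε : ℝ} (hε : 0 < ε) (hp : ∀ n, 1 ≤ n → ε ≤ p n)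
    (hinf : ∀ᵐ ω ∂μ, (regenerationTimes Z ω).Infinite) {k : ℕ} (hk : 1 ≤ k) :
    ∀ᵐ ω ∂μ, (strongRegenerationTimes Z k ω).Infinite := by
  induction k, hk using Nat.le_induction with
  | base =>
    filter_upwards [hinf] with ω hω
    simpa [strongRegenerationTimes] using hω
  | succ k hk ih =>
    filter_upwards [ih, ae_mem_limsup_atTop_iff (ℱ := historyFiltration hZ.measurable) μ
      (measurableSet_zeroRunEndingAt Z (k + 1)),
      ae_all_iff.2 (condExp_zeroRunEndingAt_succ hZ hk)] with ω h1 h2 h3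
    rw [← mem_limsup_zeroRunEndingAt (by omega), h2]
    rw [← mem_limsup_zeroRunEndingAt hk,
      Set.limsup_eq_tendsto_sum_indicator_atTop hε] at h1
    refine tendsto_atTop_mono (fun N => Finset.sum_le_sum fun n _ => ?_) h1
    refine le_trans ?_ (h3 n).ge
    exact Set.indicator_le_indicator (hp (n + 1) (by omega))

end

end BPVE

end

theorem theorem1 {Ω : Type*} [MeasurableSpace Ω] (μ : Measure Ω) [IsProbabilityMeasure μ]
    (p r : ℕ → ℝ) (ε : ℝ) (hε : 0 < ε)
    (hp : ∀ n, 1 ≤ n → p n = 1 / 2 - r n)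
    (hr : ∀ n, 1 ≤ n → 0 ≤ r n ∧ r n ≤ 1 / 2 - ε)
    (Z : ℕ → Ω → ℕ) (hZ : BPVE.IsBPVEWithImmigration μ p Z) :
    (Summable (fun n : ℕ => 1 / (BPVE.D p (n + 2) * Real.log ((n + 2 : ℕ) : ℝ))) →
      ∀ᵐ ω ∂μ, (BPVE.regenerationTimes Z ω).Finite) ∧
    ((∃ δ : ℝ, 0 < δ ∧ ∀ᶠ n : ℕ in atTop, BPVE.D p n ≤ δ * n * Real.log n) →
      ¬ Summable (fun n : ℕ => 1 / (BPVE.D p (n + 2) * Real.log ((n + 2 : ℕ) : ℝ))) →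
      ∀ k : ℕ, 1 ≤ k → ∀ᵐ ω ∂μ, (BPVE.strongRegenerationTimes Z k ω).Infinite) := by
  have hp' : ∀ n, 1 ≤ n → 0 < p n ∧ p n ≤ 1 / 2 := fun n hn => by
    rw [hp n hn]
    constructor <;> linarith [hr n hn]
  have hshift : Summable (fun n : ℕ => 1 / (BPVE.D p (n + 2) * Real.log ((n + 2 : ℕ) : ℝ))) ↔
      Summable (fun n : ℕ => 1 / (BPVE.D p n * Real.log n)) :=
    summable_nat_add_iff (f := fun n : ℕ => 1 / (BPVE.D p n * Real.log n)) 2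
  rw [hshift]
  refine ⟨BPVE.ae_finite_zeros hp' hZ, ?_⟩
  rintro ⟨δ, hδ, hD⟩ hsum k hk
  refine BPVE.ae_infinite_strongRegenerationTimes hZ hε (fun n hn => ?_)
    (BPVE.ae_infinite_zeros hp' hZ hδ hD hsum) hk
  rw [hp n hn]
  linarith [hr n hn]
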